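/- Consider a finite-state erasure channel with state space $\mathcal C=\{1,\dots,k\}$: the channel state $(C_n)_{n\ge 1}$ is a Markov chain with stochastic transition matrix $\mathbf B$, and a symbol sent at time $n$ is erased with probability $\varepsilon_{C_n}\in[0,1]$. Codewords of $N$ symbols carrying $K\le N$ information bits are sent one after the other; codeword $s\ge 0$ occupies times $sN+1,\dots,(s+1)N$. If $e$ of its symbols are erased, its decoding fails with probability $P_{\mathrm f}(N-K,e)$, where $P_{\mathrm f}(p,e)=1-\prod_{l=0}^{e-1}(1-2^{l-p})$ for $e\le p$ and $P_{\mathrm f}(p,e)=1$ for $e>p$, the outcomes of different codewords being conditionally independent given the channel states. Let $D_s\in\{0,1\}$ indicate that codeword $s$ is decoded, and set $$\kappa_{ij}=\Pr(D_0=0,\,C_{N+1}=j\mid C_1=i),\qquad \mu_{ij}=\Pr(D_0=1,\,C_{N+1}=j\mid C_1=i),$$ $\mathbf K=(\kappa_{ij})$, $\mathbf M=(\mu_{ij})$. The pair $V_s=(C_{(s+1)N+1},D_s)$ is a Markov chain on $\mathcal C\times\{0,1\}$; its transition matrix $\mathbf\Pi=(\pi(v,w))$ has the entries $\pi((i,d),(j,0))=\kappa_{ij}$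 and $\pi((i,d),(j,1))=\mu_{ij}$. Starting from a queue $Q_0=1$ with $Q_{s+1}=(Q_s-D_s)^+$, let $T=\inf\{s\ge 0: Q_s=0\}$ be the sojourn time, and let $\mathbf G_T(z)$ be the $k\times k$ matrix with entries $$[\mathbf G_T(z)]_{ij}=\mathrm E\big[z^{T}\mathbf 1_{\{T<\infty,\ C_{NT+1}=j\}}\,\big|\,C_1=i\big]\in[0,\infty],\qquad z>0.$$ Let $\varrho$ denote the spectral radius, with $\varrho=\infty$ for a nonnegative matrix that has an infinite entry. For $x\in\mathbb R$ let $$\Lambda^*(x)=\sup_{\lambda\in\mathbb R}\{\lambda x-\log\varrho(\mathbf G_T(e^{\lambda}))\},\qquad I(x)=\sup_{\lambda\in\mathbb R}\{\lambda x-\log\varrho(\mathbf\Pi_\lambda)\},$$ where $\mathbf\Pi_\lambda$ has the entries $\pi(v,w)e^{\lambda d}$ for $w=(j,d)$; these are the rate functions of the mean sojourn time $\frac1m\sum_{q=1}^m T_q$ per level and of the empirical mean service $\frac1s\sum_{t=1}^s D_t$. Assume that $\mathbf B$ is irreducible and aperiodic, that $\varepsilon_i<1$ for some $i$, and that the matrices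 $(\mathbf I-\mathbf K)^{-1}\mathbf M$ and $\mathbf\Pi$ are irreducible. If $\Lambda^*$ is finite on $(1,\infty)$ and $I$ is finite on $(0,1)$, then $$I(x)=x\,\Lambda^*\!\left(\frac1x\right)\qquad\text{for all }x\in(0,1).$$ -/

import Mathlib

open MeasureTheory ProbabilityTheory
open scoped ENNReal BigOperators

noncomputable section

namespace ErasureQueue

/-! ### Generic notions -/

/-- A biased coin: `true` with probability `p`. -/
def coin (p : ℝ) (h0 : 0 ≤ p) (h1 : p ≤ 1) : PMF Bool :=
  PMF.ofFintype (fun b => cond b (ENNReal.ofReal p) (ENNReal.ofReal (1 - p))) (by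
    rw [Fintype.sum_bool, cond_true, cond_false, ← ENNReal.ofReal_add h0 (sub_nonneg.mpr h1)]
    simp)

/-- The law, on trajectories `ℕ → S`, of the time-homogeneous Markov chain on a finite set `S`
with one-step laws `Q` and (deterministic) initial state `v`. -/
def markovLaw {S : Type} [Fintype S] [MeasurableSpace S] [MeasurableSingletonClass S]
    (Q : S → PMF S) (v : S) : Measure (ℕ → S) :=
  haveI _hQ : IsMarkovKernel (Kernel.ofFunOfCountable fun s => (Q s).toMeasure) :=
    ⟨fun s => PMF.toMeasure.isProbabilityMeasure (Q s)⟩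
  Kernel.trajMeasure (X := fun _ => S) (Measure.dirac v) fun n =>
    (Kernel.ofFunOfCountable fun s => (Q s).toMeasure).comap
      (fun x : (i : Finset.Iic n) → S => x ⟨n, Finset.mem_Iic.mpr le_rfl⟩)
      (measurable_pi_apply _)

/-- Every state is aperiodic for `B`: the only natural number dividing all return times to `i`
is `1`. -/
def IsAperiodic {k : ℕ} (B : Matrix (Fin k) (Fin k) ℝ) : Prop :=
  ∀ i, ∀ d : ℕ, (∀ n : ℕ, 0 < n → 0 < (B ^ n) i i → d ∣ n) → d = 1

/-- Spectral radius of a real matrix: the largest modulus of a complex eigenvalue. -/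
def specRadius {ι : Type} [Fintype ι] [DecidableEq ι] (A : Matrix ι ι ℝ) : ℝ≥0∞ :=
  spectralRadius ℂ (A.map (fun a : ℝ => (a : ℂ)))

open scoped Classical in
/-- Spectral radius of a nonnegative matrix over the extended reals: `∞` as soon as an entry is
infinite. -/
def extSpecRadius {ι : Type} [Fintype ι] [DecidableEq ι] (A : Matrix ι ι ℝ≥0∞) : ℝ≥0∞ :=
  if ∃ i j, A i j = ∞ then ∞ else specRadius (A.map ENNReal.toReal)

/-! ### Decoding failures -/

/-- Average probability that maximum-likelihood decoding fails, for a uniformly random binary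
parity-check matrix with `p` rows, when `e` symbols have been erased. -/
def failProb (p e : ℕ) : ℝ :=
  if e ≤ p then 1 - ∏ l ∈ Finset.range e, (1 - (2 : ℝ) ^ ((l : ℤ) - (p : ℤ))) else 1

theorem failProb_mem (p e : ℕ) : 0 ≤ failProb p e ∧ failProb p e ≤ 1 := by
  unfold failProb
  split_ifs with h
  · have hf : ∀ l ∈ Finset.range e, 0 ≤ 1 - (2 : ℝ) ^ ((l : ℤ) - (p : ℤ)) ∧
        1 - (2 : ℝ) ^ ((l : ℤ) - (p : ℤ)) ≤ 1 := by
      intro l hl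
      have hl' := Finset.mem_range.mp hl
      have h1 : (2 : ℝ) ^ ((l : ℤ) - (p : ℤ)) ≤ 1 :=
        zpow_le_one_of_nonpos₀ (by norm_num) (by omega)
      have h2 : (0 : ℝ) < (2 : ℝ) ^ ((l : ℤ) - (p : ℤ)) := by positivity
      constructor <;> linarith
    have a := Finset.prod_nonneg fun l hl => (hf l hl).1
    have b := Finset.prod_le_one (fun l hl => (hf l hl).1) fun l hl => (hf l hl).2
    constructor <;> linarith
  · norm_num

/-! ### The communication system -/

/-- A finite-state erasure channel with states `Fin k`, together with the parameters of the random
code: `blockLength` symbols (channel uses) and `infoBits` information bits per codeword. -/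
structure System (k : ℕ) where
  /-- transition probabilities of the channel state -/
  B : Matrix (Fin k) (Fin k) ℝ
  B_nonneg : ∀ i j, 0 ≤ B i j
  B_row_sum : ∀ i, ∑ j, B i j = 1
  /-- erasure probability in each channel state -/
  ε : Fin k → ℝ
  ε_nonneg : ∀ i, 0 ≤ ε i
  ε_le_one : ∀ i, ε i ≤ 1
  blockLength : ℕ
  infoBits : ℕ
  infoBits_le : infoBits ≤ blockLength

namespace System

variable {k : ℕ} (S : System k)

/-- Law of the next channel state, given that the current one is `i`. -/
def stepLaw (i : Fin k) : PMF (Fin k) :=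
  PMF.ofFintype (fun j => ENNReal.ofReal (S.B i j)) (by
    rw [← ENNReal.ofReal_sum_of_nonneg fun j _ => S.B_nonneg i j, S.B_row_sum]
    simp)

/-- Given that the channel is in state `i` at time `1`, the joint law of its state at time `n + 1`
and of the number of erasures during the `n` channel uses `1, …, n`. -/
def erasureLaw : ℕ → Fin k → PMF (Fin k × ℕ)
  | 0, i => PMF.pure (i, 0)
  | n + 1, i =>
    (coin (S.ε i) (S.ε_nonneg i) (S.ε_le_one i)).bind fun erased =>
      (S.stepLaw i).bind fun j =>
        (erasureLaw n j).map fun r => (r.1, r.2 + cond erased 1 0)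

/-- Given the channel state `i` at the onset of a codeword, the joint law of the channel state at
the onset of the next codeword and of the indicator of successful decoding. -/
def blockLaw (i : Fin k) : PMF (Fin k × Bool) :=
  (S.erasureLaw S.blockLength i).bind fun r =>
    (coin (failProb (S.blockLength - S.infoBits) r.2)
        (failProb_mem _ _).1 (failProb_mem _ _).2).map fun failed => (r.1, !failed)

/-- `κ i j`: from channel state `i`, move to `j` over one codeword, with a decoding failure. -/
def matK : Matrix (Fin k) (Fin k) ℝ :=
  Matrix.of fun i j => (S.blockLaw i (j, false)).toReal

/-- `μ i j`: from channel state `i`, move to `j` over one codeword, with a decoding success. -/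
def matM : Matrix (Fin k) (Fin k) ℝ :=
  Matrix.of fun i j => (S.blockLaw i (j, true)).toReal

/-- Transition matrix of the chain
`V = (channel state at the onset of the next codeword, success indicator of the codeword)`. -/
def matPi : Matrix (Fin k × Bool) (Fin k × Bool) ℝ :=
  Matrix.of fun v w => (S.blockLaw v.1 w).toReal

/-- The tilted matrix, with entries `π (v, w) * exp (θ * d)`, where `d ∈ {0, 1}` is the success
indicator in `w`. -/
def tiltedPi (θ : ℝ) : Matrix (Fin k × Bool) (Fin k × Bool) ℝ :=
  Matrix.of fun v w => S.matPi v w * Real.exp (θ * cond w.2 1 0)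

/-- Rate function of the empirical mean service: the Fenchel-Legendre transform of the logarithm
of the spectral radius of the tilted matrix. -/
def rateI (x : ℝ) : EReal :=
  ⨆ θ : ℝ, ((θ * x : ℝ) : EReal) - ENNReal.log (specRadius (S.tiltedPi θ))

/-- Law of the process when the channel starts in state `i`. A trajectory `ω` records
at index `s` the channel state at the onset of codeword `s` and, when `s ≥ 1`, whether codeword
`s - 1` has been decoded; the indicator at index `0` is a dummy. -/
def law (i : Fin k) : Measure (ℕ → Fin k × Bool) :=
  markovLaw (fun v : Fin k × Bool => S.blockLaw v.1) (i, false)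

/-- Number of queued segments at the onset of codeword `s`, starting with `m` segments: it drops
by one whenever a codeword is decoded, and stays at `0` once there. -/
def queue (m : ℕ) (ω : ℕ → Fin k × Bool) : ℕ → ℕ
  | 0 => m
  | s + 1 => queue m ω s - cond (ω (s + 1)).2 1 0

/-- The sojourn time `T`: the first time at which a queue started at level `1` is empty. -/
def sojourn (ω : ℕ → Fin k × Bool) : ℕ∞ :=
  ⨅ (s : ℕ) (_ : queue 1 ω s = 0), (s : ℕ∞)

/-- The matrix generating function of `T`: entry `(i, j)` is the expectation of
`z ^ T * 1{the channel state at the onset of codeword T is j}` (with the value `0` on `T = ∞`),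
given the initial channel state `i`. -/
def genT (z : ℝ≥0∞) : Matrix (Fin k) (Fin k) ℝ≥0∞ :=
  Matrix.of fun i j => ∫⁻ ω,
    (if sojourn ω ≠ ⊤ ∧ (ω (sojourn ω).toNat).1 = j then z ^ (sojourn ω).toNat else 0) ∂(S.law i)

/-- Rate function of the empirical mean sojourn time: the Fenchel-Legendre transform of the
logarithm of the spectral radius of the matrix generating function at `exp θ`. -/
def rateLambda (x : ℝ) : EReal :=
  ⨆ θ : ℝ, ((θ * x : ℝ) : EReal) -
    ENNReal.log (extSpecRadius (S.genT (ENNReal.ofReal (Real.exp θ))))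

end System

end ErasureQueue

end

namespace ErasureQueue

/-! ### Perron–Frobenius theory for irreducible matrices. -/

section Matrices

open Matrix Filter Topology

variable {ι : Type} [Fintype ι]

/-! The two log-spectral radii are, up to signs, inverse functions of each other. Decomposing at the
first success gives `G(z) = ∑ z ^ (n + 1) K ^ n M` for the generating matrix of `T` (`genT_apply`).
Formally `G(z) = z (1 - z K)⁻¹ M`, so for a positive vector `v` the equations `(K + c M) v = φ v`
and `G(φ⁻¹) v = c⁻¹ v` are equivalent. A positive eigenvector of a nonnegative matrix determines its
spectral radius (`specRadius_eq_of_pos_eigenvector`), and the tilted `Π` has the spectral radius of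
`K + exp θ M` (`specRadius_tiltedPi`). Hence `log ϱ(Π_θ) = -l` goes with `log ϱ(G(exp l)) = -θ`, and
`θ x + l = x (l / x + θ)` matches the two suprema term by term; an infinite `G` contributes only
`-∞`.

The delicate point is convergence of `G` exactly at `z = φ⁻¹`. It rests on `φ ^ (-n) K ^ n v → 0`
(`tendsto_pow_mulVec`), after which the series telescopes (`summable_of_eigenvector`). Conversely,
where `G` is finite it is irreducible, and its Perron vector solves the other equation
(`exists_eigenvector_of_summable`). -/

theorem mulVec_nonneg {A : Matrix ι ι ℝ} (hA : ∀ i j, 0 ≤ A i j) {x : ι → ℝ}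
    (hx : ∀ i, 0 ≤ x i) (i : ι) : 0 ≤ (A *ᵥ x) i :=
  Finset.sum_nonneg fun j _ => mul_nonneg (hA i j) (hx j)

theorem mulVec_mono {A : Matrix ι ι ℝ} (hA : ∀ i j, 0 ≤ A i j) {x y : ι → ℝ}
    (hxy : ∀ i, x i ≤ y i) (i : ι) : (A *ᵥ x) i ≤ (A *ᵥ y) i :=
  Finset.sum_le_sum fun j _ => mul_le_mul_of_nonneg_left (hxy j) (hA i j)

variable [DecidableEq ι]

theorem pow_mulVec_le {A : Matrix ι ι ℝ} (hA : ∀ i j, 0 ≤ A i j) {x : ι → ℝ} {r : ℝ}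
    (hr : 0 ≤ r) (h : ∀ i, (A *ᵥ x) i ≤ r * x i) (n : ℕ) (i : ι) :
    ((A ^ n) *ᵥ x) i ≤ r ^ n * x i := by
  induction n generalizing i with
  | zero => simp
  | succ n ih =>
    rw [pow_succ', ← mulVec_mulVec]
    refine (mulVec_mono (y := r ^ n • x) hA (fun j => by simpa using ih j) i).trans ?_
    rw [mulVec_smul, Pi.smul_apply, smul_eq_mul, pow_succ, mul_assoc]
    exact mul_le_mul_of_nonneg_left (h i) (pow_nonneg hr n)

/-- A nonzero nonnegative subinvariant vector of an irreducible matrix is positive. -/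
theorem pos_of_mulVec_le {A : Matrix ι ι ℝ} (hA : A.IsIrreducible) {x : ι → ℝ} {r : ℝ}
    (hr : 0 ≤ r) (hx : ∀ i, 0 ≤ x i) {j : ι} (hj : x j ≠ 0)
    (h : ∀ i, (A *ᵥ x) i ≤ r * x i) (i : ι) : 0 < x i := by
  obtain ⟨n, -, hn⟩ := (isIrreducible_iff_exists_pow_pos hA.nonneg).1 hA i j
  have h1 : 0 < ((A ^ n) *ᵥ x) i :=
    Finset.sum_pos' (fun l _ => mul_nonneg (pow_apply_nonneg hA.nonneg n i l) (hx l))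
      ⟨j, Finset.mem_univ j, mul_pos hn ((hx j).lt_of_ne' hj)⟩
  have h2 := h1.trans_le (pow_mulVec_le hA.nonneg hr h n i)
  exact (hx i).lt_of_ne' fun h0 => by simp [h0] at h2

/-- An irreducible matrix commutes with an entrywise positive matrix. -/
theorem exists_pos_commute {A : Matrix ι ι ℝ} (hA : A.IsIrreducible) :
    ∃ Q : Matrix ι ι ℝ, Commute Q A ∧ ∀ i j, 0 < Q i j := by
  choose n _ hn using (isIrreducible_iff_exists_pow_pos hA.nonneg).1 hA
  refine ⟨∑ m ∈ Finset.univ.image (fun p : ι × ι => n p.1 p.2), A ^ m,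
    Commute.sum_left _ _ _ fun m _ => (Commute.refl A).pow_left m, fun i j => ?_⟩
  rw [Matrix.sum_apply]
  exact Finset.sum_pos' (fun m _ => pow_apply_nonneg hA.nonneg m i j)
    ⟨n i j, Finset.mem_image.2 ⟨(i, j), Finset.mem_univ _, rfl⟩, hn i j⟩

/-- Perron's theorem: an irreducible matrix has a positive eigenvector. -/
theorem exists_pos_eigenvector [Nonempty ι] {A : Matrix ι ι ℝ} (hA : A.IsIrreducible) :
    ∃ r : ℝ, 0 < r ∧ ∃ v : ι → ℝ, (∀ i, 0 < v i) ∧ A *ᵥ v = r • v := by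
  obtain ⟨Q, hQA, hQ⟩ := exists_pos_commute hA
  set R : ℝ := ∑ i, ∑ j, A i j
  -- Collatz–Wielandt: the Perron root is the largest `r` with `r x ≤ A x` for some `x` in the
  -- simplex. Compactness of this set provides a maximizer.
  set C : Set (ℝ × (ι → ℝ)) :=
    {p | 0 ≤ p.1 ∧ p.2 ∈ stdSimplex ℝ ι ∧ ∀ i, p.1 * p.2 i ≤ (A *ᵥ p.2) i} with hC
  have hsub : C ⊆ Set.Icc 0 R ×ˢ stdSimplex ℝ ι := by
    rintro ⟨r, x⟩ ⟨hr, hx, h⟩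
    refine ⟨⟨hr, ?_⟩, hx⟩
    calc r = ∑ i, r * x i := by rw [← Finset.mul_sum, hx.2, mul_one]
      _ ≤ ∑ i, (A *ᵥ x) i := Finset.sum_le_sum fun i _ => h i
      _ ≤ R := Finset.sum_le_sum fun i _ => Finset.sum_le_sum fun j _ =>
        mul_le_of_le_one_right (hA.nonneg i j)
          ((Finset.single_le_sum (fun l _ => hx.1 l) (Finset.mem_univ j)).trans_eq hx.2)
  have hclosed : IsClosed C := by
    refine (isClosed_le continuous_const continuous_fst).inter
      (((isClosed_stdSimplex ℝ ι).preimage continuous_snd).inter ?_)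
    change IsClosed {p : ℝ × (ι → ℝ) | ∀ i, p.1 * p.2 i ≤ (A *ᵥ p.2) i}
    simp only [Set.ofPred_forall]
    refine isClosed_iInter fun i => isClosed_le (by fun_prop) ?_
    simp only [mulVec, dotProduct]
    fun_prop
  have hcomp : IsCompact C :=
    (isCompact_Icc.prod (isCompact_stdSimplex ℝ ι)).of_isClosed_subset hclosed hsub
  have hne : C.Nonempty := by
    obtain ⟨i⟩ := ‹Nonempty ι›
    refine ⟨(0, Pi.single i 1), le_rfl, single_mem_stdSimplex ℝ i, fun j => ?_⟩
    simpa using mulVec_nonneg hA.nonneg (single_mem_stdSimplex ℝ i).1 j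
  obtain ⟨⟨r, x⟩, ⟨hr, hx, hrx⟩, hmax⟩ := hcomp.exists_isMaxOn hne continuous_fst.continuousOn
  dsimp only at hr hx hrx
  obtain ⟨j, hj⟩ : ∃ j, x j ≠ 0 := by
    by_contra! h
    have := hx.2
    simp [h] at this
  have hpos : ∀ {y : ι → ℝ}, (∀ i, 0 ≤ y i) → (∃ l, y l ≠ 0) → ∀ i, 0 < (Q *ᵥ y) i :=
    fun {y} hy ⟨l, hl⟩ i => Finset.sum_pos' (fun m _ => mul_nonneg (hQ i m).le (hy m))
      ⟨l, Finset.mem_univ l, mul_pos (hQ i l) ((hy l).lt_of_ne' hl)⟩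
  -- Otherwise the defect `A x - r x` is nonnegative and nonzero, so `Q` makes it strictly positive.
  -- As `Q` commutes with `A`, the vector `Q x`, once normalized, admits a ratio larger than `r`.
  have heq : A *ᵥ x = r • x := by
    by_contra hne'
    have hw := hpos hx.1 ⟨j, hj⟩
    have hd : ∀ i, 0 < (Q *ᵥ (A *ᵥ x - r • x)) i := by
      refine hpos (fun i => ?_) ?_
      · simpa using hrx i
      · by_contra! h
        exact hne' (sub_eq_zero.1 (funext h))
    have hd' : ∀ i, r * (Q *ᵥ x) i < (A *ᵥ (Q *ᵥ x)) i := by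
      intro i
      have := hd i
      rw [mulVec_sub, mulVec_smul, mulVec_mulVec, hQA.eq, ← mulVec_mulVec] at this
      simpa using this
    set w := Q *ᵥ x
    set s := ∑ i, w i
    have hs : 0 < s := Finset.sum_pos (fun i _ => hw i) Finset.univ_nonempty
    obtain ⟨i₀, -, hi₀⟩ := Finset.exists_min_image Finset.univ
      (fun i => (A *ᵥ w) i / w i) Finset.univ_nonempty
    have hlt : r < (A *ᵥ w) i₀ / w i₀ := by rw [lt_div_iff₀ (hw i₀)]; exact hd' i₀
    have hmem : ((A *ᵥ w) i₀ / w i₀, s⁻¹ • w) ∈ C := by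
      refine ⟨hr.trans hlt.le, ⟨fun i => mul_nonneg (inv_nonneg.2 hs.le) (hw i).le, ?_⟩,
        fun i => ?_⟩
      · simp only [Pi.smul_apply, smul_eq_mul, ← Finset.mul_sum]
        exact inv_mul_cancel₀ hs.ne'
      · have := (le_div_iff₀ (hw i)).1 (hi₀ i (Finset.mem_univ i))
        rw [mulVec_smul]
        simp only [Pi.smul_apply, smul_eq_mul]
        rw [mul_left_comm]
        exact mul_le_mul_of_nonneg_left this (inv_nonneg.2 hs.le)
    exact absurd (hmax hmem) (not_le.2 hlt)
  have hxpos := pos_of_mulVec_le hA hr hx.1 hj fun i => by rw [heq]; rfl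
  refine ⟨r, hr.lt_of_ne' fun h0 => ?_, x, hxpos, heq⟩
  obtain ⟨n, hn, hn'⟩ := (isIrreducible_iff_exists_pow_pos hA.nonneg).1 hA j j
  have h1 : 0 < ((A ^ n) *ᵥ x) j :=
    Finset.sum_pos' (fun l _ => mul_nonneg (pow_apply_nonneg hA.nonneg n j l) (hx.1 l))
      ⟨j, Finset.mem_univ j, mul_pos hn' (hxpos j)⟩
  have h2 := pow_mulVec_le hA.nonneg hr (fun i => by rw [heq]; rfl) n j
  rw [h0, zero_pow hn.ne'] at h2
  linarith

/-- A nonnegative matrix with a positive eigenvector has the eigenvalue as spectral radius. -/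
theorem specRadius_eq_of_pos_eigenvector [Nonempty ι] {A : Matrix ι ι ℝ} (hA : ∀ i j, 0 ≤ A i j)
    {r : ℝ} (hr : 0 ≤ r) {v : ι → ℝ} (hv : ∀ i, 0 < v i) (h : A *ᵥ v = r • v) :
    specRadius A = ENNReal.ofReal r := by
  have hspec : ∀ μ : ℂ, μ ∈ spectrum ℂ (A.map (fun a : ℝ => (a : ℂ))) ↔
      ∃ y : ι → ℂ, A.map (fun a : ℝ => (a : ℂ)) *ᵥ y = μ • y ∧ y ≠ 0 := by
    intro μ
    rw [← Matrix.spectrum_toLin', ← Module.End.hasEigenvalue_iff_mem_spectrum]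
    constructor
    · intro hμ
      obtain ⟨y, hy⟩ := hμ.exists_hasEigenvector
      exact ⟨y, by simpa using hy.apply_eq_smul, hy.2⟩
    · rintro ⟨y, hy, hy0⟩
      exact Module.End.hasEigenvalue_of_hasEigenvector
        ⟨Module.End.mem_eigenspace_iff.2 (by simpa using hy), hy0⟩
  unfold specRadius spectralRadius
  apply le_antisymm
  · refine iSup₂_le fun μ hμ => ?_
    obtain ⟨y, hy, hy0⟩ := (hspec μ).1 hμ
    -- In the sup norm weighted by `v`, the matrix has operator norm at most `r`; the eigenvalue
    -- bound is read off where the weighted norm of `y` is attained.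
    obtain ⟨i, -, hi⟩ := Finset.exists_max_image Finset.univ
      (fun i => ‖y i‖ / v i) Finset.univ_nonempty
    have hle : ∀ j, ‖y j‖ ≤ ‖y i‖ / v i * v j := fun j =>
      (div_le_iff₀ (hv j)).1 (hi j (Finset.mem_univ j))
    have hyi : 0 < ‖y i‖ := by
      obtain ⟨j, hj⟩ := Function.ne_iff.1 hy0
      have h1 : 0 < ‖y j‖ := norm_pos_iff.2 hj
      refine (norm_nonneg _).lt_of_ne' fun h0 => ?_
      have := hle j
      rw [h0] at this
      simp at this
      exact hj this
    have hb : ‖μ‖ * ‖y i‖ ≤ r * ‖y i‖ := by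
      calc ‖μ‖ * ‖y i‖ = ‖(A.map (fun a : ℝ => (a : ℂ)) *ᵥ y) i‖ := by
            rw [hy, Pi.smul_apply, smul_eq_mul, norm_mul]
        _ ≤ ∑ j, A i j * ‖y j‖ := by
            refine (norm_sum_le _ _).trans_eq (Finset.sum_congr rfl fun j _ => ?_)
            simp [abs_of_nonneg (hA i j)]
        _ ≤ ∑ j, A i j * (‖y i‖ / v i * v j) :=
            Finset.sum_le_sum fun j _ => mul_le_mul_of_nonneg_left (hle j) (hA i j)
        _ = ‖y i‖ / v i * (A *ᵥ v) i := by
            rw [mulVec, dotProduct, Finset.mul_sum]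
            exact Finset.sum_congr rfl fun j _ => by ring
        _ = r * ‖y i‖ := by
            rw [h, Pi.smul_apply, smul_eq_mul]
            field_simp [(hv i).ne']
    have := le_of_mul_le_mul_right hb hyi
    rw [← ENNReal.ofReal_coe_nnreal, coe_nnnorm]
    exact ENNReal.ofReal_le_ofReal this
  · have hmem : (r : ℂ) ∈ spectrum ℂ (A.map (fun a : ℝ => (a : ℂ))) := by
      refine (hspec r).2 ⟨fun i => (v i : ℂ), funext fun i => ?_, fun h0 => ?_⟩
      · have := congrArg (fun t : ℝ => (t : ℂ)) (congrFun h i)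
        simpa [mulVec, dotProduct] using this
      · obtain ⟨i⟩ := ‹Nonempty ι›
        have := congrFun h0 i
        simp [(hv i).ne'] at this
    refine le_trans ?_ (le_iSup₂ (f := fun (k : ℂ) (_ : k ∈ spectrum ℂ _) => (‖k‖₊ : ℝ≥0∞)) _ hmem)
    rw [← ENNReal.ofReal_coe_nnreal]
    simp [abs_of_nonneg hr]

/-- Irreducibility passes to images of the graph of positive entries. -/
theorem isIrreducible_of_surjective {κ : Type} [Fintype κ] [DecidableEq κ]
    {A : Matrix ι ι ℝ} (hA : A.IsIrreducible) {B : Matrix κ κ ℝ} (hB : ∀ i j, 0 ≤ B i j)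
    {f : ι → κ} (hf : Function.Surjective f) (h : ∀ i j, 0 < A i j → 0 < B (f i) (f j)) :
    B.IsIrreducible := by
  have key : ∀ n i j, 0 < (A ^ n) i j → 0 < (B ^ n) (f i) (f j) := by
    intro n
    induction n with
    | zero =>
      intro i j hij
      rcases eq_or_ne i j with rfl | hne
      · simp
      · simp [hne] at hij
    | succ n ih =>
      intro i j hij
      rw [pow_succ, mul_apply] at hij ⊢
      obtain ⟨l, -, hl⟩ := (Finset.sum_pos_iff_of_nonneg fun l _ =>
        mul_nonneg (pow_apply_nonneg hA.nonneg n i l) (hA.nonneg l j)).1 hij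
      have h1 : 0 < (A ^ n) i l := (pow_apply_nonneg hA.nonneg n i l).lt_of_ne' fun h0 => by
        simp [h0] at hl
      have h2 : 0 < A l j := (hA.nonneg l j).lt_of_ne' fun h0 => by simp [h0] at hl
      exact Finset.sum_pos' (fun m _ => mul_nonneg (pow_apply_nonneg hB n _ m) (hB m _))
        ⟨f l, Finset.mem_univ _, mul_pos (ih i l h1) (h l j h2)⟩
  rw [isIrreducible_iff_exists_pow_pos hB]
  intro i j
  obtain ⟨i, rfl⟩ := hf i
  obtain ⟨j, rfl⟩ := hf j
  obtain ⟨n, hn, hn'⟩ := (isIrreducible_iff_exists_pow_pos hA.nonneg).1 hA i j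
  exact ⟨n, hn, key n i j hn'⟩

end Matrices

end ErasureQueue

namespace ErasureQueue

/-! ### Eigenvectors of `K + c M` and of the series `∑ z ^ (n + 1) K ^ n M`. -/

section Kernels

open Matrix Filter Topology

variable {ι : Type} [Fintype ι] [DecidableEq ι]

omit [DecidableEq ι] in
-- Evaluate `u ⬝ A v` in two ways; positivity of `u` makes `u ⬝ v` nonzero even if `v` has zeros.
theorem eigenvalue_eq_of_pos [Nonempty ι] {A : Matrix ι ι ℝ} {r s : ℝ} {u v : ι → ℝ}
    (hu : ∀ i, 0 < u i) (hv : ∀ i, 0 ≤ v i) (hv0 : ∃ i, v i ≠ 0) (hAu : Aᵀ *ᵥ u = r • u)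
    (hAv : A *ᵥ v = s • v) : r = s := by
  have h1 : r * (u ⬝ᵥ v) = s * (u ⬝ᵥ v) := by
    rw [← smul_eq_mul, ← smul_dotProduct, ← hAu, mulVec_transpose, ← dotProduct_mulVec, hAv,
      dotProduct_smul, smul_eq_mul]
  obtain ⟨i, hi⟩ := hv0
  have h2 : 0 < u ⬝ᵥ v := Finset.sum_pos' (fun m _ => mul_nonneg (hu m).le (hv m))
    ⟨i, Finset.mem_univ i, mul_pos (hu i) ((hv i).lt_of_ne' hi)⟩
  exact mul_right_cancel₀ h2.ne' h1

/-- If `K` has no fixed vector and `K + M` is stochastic, then `K ^ n` decays strictly faster than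
the Perron eigenvalue of an irreducible matrix `K + c M`. -/
theorem tendsto_pow_mulVec [Nonempty ι] {K M : Matrix ι ι ℝ} (hK : ∀ i j, 0 ≤ K i j)
    (hM : ∀ i j, 0 ≤ M i j) (hKM : (K + M).IsIrreducible) (hsto : (K + M) *ᵥ 1 = 1)
    (hfix : ∀ w, K *ᵥ w = w → w = 0) {c φ : ℝ} (hc : 0 < c) (hφ : 0 < φ)
    (hirr : (K + c • M).IsIrreducible) {v : ι → ℝ} (hv : ∀ i, 0 < v i)
    (h : (K + c • M) *ᵥ v = φ • v) :
    Tendsto (fun n : ℕ => φ⁻¹ ^ n • (K ^ n *ᵥ v)) atTop (𝓝 0) := by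
  set a : ℕ → ι → ℝ := fun n => φ⁻¹ ^ n • (K ^ n *ᵥ v)
  have hKv : ∀ i, (K *ᵥ v) i ≤ φ * v i := by
    intro i
    have h1 : (K *ᵥ v) i + c * (M *ᵥ v) i = φ * v i := by
      simpa [add_mulVec, smul_mulVec] using congrFun h i
    have := mul_nonneg hc.le (mulVec_nonneg hM (fun j => (hv j).le) i)
    linarith
  have ha0 : ∀ n i, 0 ≤ a n i := fun n i => mul_nonneg (by positivity)
    (mulVec_nonneg (pow_apply_nonneg hK n) (fun j => (hv j).le) i)
  -- Since `K v ≤ φ v`, the sequence decreases entrywise. Its limit `w` satisfies `K w = φ w`, and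
  -- it remains to exclude `w ≠ 0`.
  have hanti : ∀ i, Antitone fun n => a n i := by
    refine fun i => antitone_nat_of_succ_le fun n => ?_
    have h1 := mulVec_mono (y := φ • v) (pow_apply_nonneg hK n) (fun j => hKv j) i
    rw [mulVec_mulVec, ← pow_succ, mulVec_smul, Pi.smul_apply, smul_eq_mul] at h1
    calc φ⁻¹ ^ (n + 1) * (K ^ (n + 1) *ᵥ v) i
        ≤ φ⁻¹ ^ (n + 1) * (φ * (K ^ n *ᵥ v) i) :=
          mul_le_mul_of_nonneg_left h1 (by positivity)
      _ = φ⁻¹ ^ n * (K ^ n *ᵥ v) i := by rw [pow_succ]; field_simp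
  have hlim : ∀ i, ∃ w, Tendsto (fun n => a n i) atTop (𝓝 w) := fun i =>
    ⟨_, tendsto_atTop_ciInf (hanti i) ⟨0, by rintro _ ⟨n, rfl⟩; exact ha0 n i⟩⟩
  choose w hw using hlim
  have haw : Tendsto a atTop (𝓝 w) := tendsto_pi_nhds.2 hw
  have hw0 : ∀ i, 0 ≤ w i := fun i => ge_of_tendsto' (hw i) fun n => ha0 n i
  have hKw : K *ᵥ w = φ • w := by
    have hcont : Continuous fun x : ι → ℝ => K *ᵥ x := by fun_prop
    refine tendsto_nhds_unique ((hcont.tendsto w).comp haw) ?_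
    have : (fun x => K *ᵥ x) ∘ a = fun n => φ • a (n + 1) := by
      funext n
      simp only [Function.comp, a]
      rw [mulVec_smul, mulVec_mulVec, ← pow_succ', smul_smul, pow_succ' φ⁻¹, ← mul_assoc,
        mul_inv_cancel₀ hφ.ne', one_mul]
    rw [this]
    exact ((tendsto_add_atTop_iff_nat 1).2 haw).const_smul φ
  suffices hwz : w = 0 by rwa [hwz] at haw
  by_contra hwne
  obtain ⟨i, hi⟩ := Function.ne_iff.1 hwne
  obtain ⟨r, -, u, hu, hAu⟩ := exists_pos_eigenvector hirr.transpose
  have hr : r = φ := eigenvalue_eq_of_pos hu (fun i => (hv i).le) ⟨i, (hv i).ne'⟩ hAu h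
  have hMw0 : ∀ i, 0 ≤ (M *ᵥ w) i := mulVec_nonneg hM hw0
  -- Pairing with the positive left eigenvector `u` of `K + c M` leaves no room for a contribution
  -- of `M w`.
  have hMw : M *ᵥ w = 0 := by
    have h1 : u ⬝ᵥ ((K + c • M) *ᵥ w) = φ * (u ⬝ᵥ w) := by
      rw [dotProduct_mulVec, ← mulVec_transpose, hAu, hr, smul_dotProduct, smul_eq_mul]
    rw [add_mulVec, hKw, smul_mulVec, dotProduct_add, dotProduct_smul, dotProduct_smul,
      smul_eq_mul, smul_eq_mul] at h1
    have h2 : u ⬝ᵥ (M *ᵥ w) = 0 := by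
      have : c * (u ⬝ᵥ (M *ᵥ w)) = 0 := by linarith
      exact (mul_eq_zero.1 this).resolve_left hc.ne'
    funext j
    have h3 := (Finset.sum_eq_zero_iff_of_nonneg
      fun j _ => mul_nonneg (hu j).le (hMw0 j)).1 h2 j (Finset.mem_univ j)
    exact (mul_eq_zero.1 h3).resolve_left (hu j).ne'
  -- Now `(K + M) w = φ w`. As `K + M` is irreducible and fixes the constant vector, `φ = 1`, so `w`
  -- is a fixed vector of `K`.
  obtain ⟨r', -, u', hu', hAu'⟩ := exists_pos_eigenvector hKM.transpose
  have h1 : r' = φ := eigenvalue_eq_of_pos hu' hw0 ⟨i, hi⟩ hAu' (by rw [add_mulVec, hKw, hMw, add_zero])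
  have h2 : r' = 1 := eigenvalue_eq_of_pos (v := 1) hu' (fun _ => zero_le_one) ⟨i, by simp⟩ hAu'
    (by rw [hsto, one_smul])
  refine hwne (hfix w ?_)
  rw [hKw, ← h1, h2, one_smul]

/-- The real matrix `∑ z ^ (n + 1) K ^ n M`. -/
noncomputable def returnMatrix (K M : Matrix ι ι ℝ) (z : ℝ) : Matrix ι ι ℝ :=
  Matrix.of fun i j => ∑' n : ℕ, z ^ (n + 1) * (K ^ n * M) i j

/-- Substituting `M v = c⁻¹ (φ v - K v)` telescopes the series applied to `v`, and the remainder
tends to `0`. Positivity of `v` then gives entrywise summability. -/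
theorem summable_of_eigenvector [Nonempty ι] {K M : Matrix ι ι ℝ} (hK : ∀ i j, 0 ≤ K i j)
    (hM : ∀ i j, 0 ≤ M i j) (hKM : (K + M).IsIrreducible) (hsto : (K + M) *ᵥ 1 = 1)
    (hfix : ∀ w, K *ᵥ w = w → w = 0) {c φ : ℝ} (hc : 0 < c) (hφ : 0 < φ)
    (hirr : (K + c • M).IsIrreducible) {v : ι → ℝ} (hv : ∀ i, 0 < v i)
    (h : (K + c • M) *ᵥ v = φ • v) :
    (∀ i j, Summable fun n : ℕ => φ⁻¹ ^ (n + 1) * (K ^ n * M) i j) ∧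
      returnMatrix K M φ⁻¹ *ᵥ v = c⁻¹ • v := by
  have hlim := tendsto_pow_mulVec hK hM hKM hsto hfix hc hφ hirr hv h
  have hnn : ∀ n i j, 0 ≤ φ⁻¹ ^ (n + 1) * (K ^ n * M) i j := fun n i j =>
    mul_nonneg (by positivity)
      (Finset.sum_nonneg fun l _ => mul_nonneg (pow_apply_nonneg hK n i l) (hM l j))
  have hMv : M *ᵥ v = c⁻¹ • (φ • v - K *ᵥ v) := by
    rw [← h, add_mulVec, smul_mulVec, add_sub_cancel_left, smul_smul, inv_mul_cancel₀ hc.ne',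
      one_smul]
  have hsum : ∀ m : ℕ, ∑ n ∈ Finset.range m, φ⁻¹ ^ (n + 1) • ((K ^ n * M) *ᵥ v) =
      c⁻¹ • (v - φ⁻¹ ^ m • (K ^ m *ᵥ v)) := by
    intro m
    induction m with
    | zero => simp
    | succ m ih =>
      rw [Finset.sum_range_succ, ih, ← mulVec_mulVec, hMv, mulVec_smul, mulVec_sub, mulVec_smul,
        mulVec_mulVec, ← pow_succ, smul_comm _ c⁻¹, ← smul_add, smul_sub, smul_smul,
        pow_succ φ⁻¹ m, mul_assoc, inv_mul_cancel₀ hφ.ne', mul_one]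
      congr 1
      abel
  have hhas : ∀ i, HasSum (fun n : ℕ => ∑ j, φ⁻¹ ^ (n + 1) * (K ^ n * M) i j * v j)
      (c⁻¹ * v i) := by
    intro i
    rw [hasSum_iff_tendsto_nat_of_nonneg
      fun n => Finset.sum_nonneg fun j _ => mul_nonneg (hnn n i j) (hv j).le]
    have h1 := tendsto_pi_nhds.1 ((tendsto_const_nhds (x := v)).sub hlim |>.const_smul c⁻¹) i
    simp only [sub_zero, Pi.smul_apply, smul_eq_mul] at h1
    refine h1.congr fun m => ?_
    have h2 := congrFun (hsum m) i
    simp only [Pi.smul_apply, smul_eq_mul, Finset.sum_apply] at h2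
    rw [← h2]
    refine Finset.sum_congr rfl fun n _ => ?_
    rw [mulVec, dotProduct, Finset.mul_sum]
    exact Finset.sum_congr rfl fun j _ => by ring
  have hS : ∀ i j, Summable fun n : ℕ => φ⁻¹ ^ (n + 1) * (K ^ n * M) i j := by
    intro i j
    have h1 : Summable fun n : ℕ => φ⁻¹ ^ (n + 1) * (K ^ n * M) i j * v j :=
      (hhas i).summable.of_nonneg_of_le (fun n => mul_nonneg (hnn n i j) (hv j).le)
        fun n => Finset.single_le_sum (f := fun j => φ⁻¹ ^ (n + 1) * (K ^ n * M) i j * v j)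
          (fun l _ => mul_nonneg (hnn n i l) (hv l).le) (Finset.mem_univ j)
    exact (summable_mul_right_iff (hv j).ne').1 h1
  refine ⟨hS, funext fun i => ?_⟩
  exact (hasSum_sum fun j _ => (hS i j).hasSum.mul_right (v j)).unique (hhas i)

theorem eq_zero_of_mulVec_eq {K : Matrix ι ι ℝ} (hdet : IsUnit (1 - K).det) {w : ι → ℝ}
    (hw : K *ᵥ w = w) : w = 0 := by
  have h0 : (1 - K) *ᵥ w = 0 := by rw [sub_mulVec, one_mulVec, hw, sub_self]
  have := congrArg (fun x => (1 - K)⁻¹ *ᵥ x) h0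
  simpa [mulVec_mulVec, nonsing_inv_mul _ hdet] using this

/-- Transfers irreducibility from `(1 - K)⁻¹ M` to the series at any `z > 0` where it converges.
With `H = (1 - K)⁻¹ M`, the partial sums of `K ^ n M` are `H - K ^ m H`, and `K ^ m → 0`; if no term
were positive at `(i, j)`, then `H i j ≤ 0`. -/
theorem exists_pow_mul_pos [Nonempty ι] {K M : Matrix ι ι ℝ} (hK : ∀ i j, 0 ≤ K i j)
    (hM : ∀ i j, 0 ≤ M i j) (hKM : (K + M).IsIrreducible) (hsto : (K + M) *ᵥ 1 = 1)
    (hdet : IsUnit (1 - K).det) {i j : ι} (hij : 0 < ((1 - K)⁻¹ * M) i j) :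
    ∃ n : ℕ, 0 < (K ^ n * M) i j := by
  have hlim := tendsto_pow_mulVec (c := 1) (φ := 1) (v := 1) hK hM hKM hsto
    (fun _ => eq_zero_of_mulVec_eq hdet) one_pos one_pos (by rwa [one_smul]) (fun _ => one_pos) (by rw [one_smul, one_smul, hsto])
  have hent : ∀ l, Tendsto (fun n : ℕ => (K ^ n) i l) atTop (𝓝 0) := by
    intro l
    have h1 := tendsto_pi_nhds.1 hlim i
    refine squeeze_zero (fun n => pow_apply_nonneg hK n i l) (fun n => ?_) h1
    have : (K ^ n) i l ≤ ∑ m, (K ^ n) i m :=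
      Finset.single_le_sum (fun m _ => pow_apply_nonneg hK n i m) (Finset.mem_univ l)
    simpa [mulVec, dotProduct] using this
  by_contra! hno
  set H := (1 - K)⁻¹ * M with hH
  have hMH : M = (1 - K) * H := by
    rw [hH, ← mul_assoc, mul_nonsing_inv _ hdet, one_mul]
  have htel : ∀ m : ℕ, ∑ n ∈ Finset.range m, K ^ n * M = (1 - K ^ m) * H := by
    intro m
    rw [← Finset.sum_mul]
    nth_rewrite 1 [hMH]
    rw [← mul_assoc, geom_sum_mul_neg]
  have hle : ∀ m : ℕ, H i j ≤ (K ^ m * H) i j := by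
    intro m
    have h1 := congrFun (congrFun (htel m) i) j
    rw [sub_mul, one_mul, Matrix.sub_apply, Matrix.sum_apply] at h1
    have := Finset.sum_nonpos fun n (_ : n ∈ Finset.range m) => hno n
    linarith
  have hz : Tendsto (fun m : ℕ => (K ^ m * H) i j) atTop (𝓝 0) := by
    simp only [mul_apply]
    simpa using tendsto_finsetSum Finset.univ fun l _ => (hent l).mul_const (H l j)
  exact absurd (ge_of_tendsto' hz hle) (not_le.2 hij)

theorem exists_eigenvector_of_summable [Nonempty ι] {K M : Matrix ι ι ℝ}
    (hK : ∀ i j, 0 ≤ K i j)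
    (hM : ∀ i j, 0 ≤ M i j) (hKM : (K + M).IsIrreducible) (hsto : (K + M) *ᵥ 1 = 1)
    (hdet : IsUnit (1 - K).det) (hG : ((1 - K)⁻¹ * M).IsIrreducible) {z : ℝ} (hz : 0 < z)
    (hS : ∀ i j, Summable fun n : ℕ => z ^ (n + 1) * (K ^ n * M) i j) :
    ∃ γ : ℝ, 0 < γ ∧ ∃ v : ι → ℝ, (∀ i, 0 < v i) ∧ returnMatrix K M z *ᵥ v = γ • v ∧
      (K + γ⁻¹ • M) *ᵥ v = z⁻¹ • v := by
  have hnn : ∀ n i j, 0 ≤ z ^ (n + 1) * (K ^ n * M) i j := fun n i j =>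
    mul_nonneg (by positivity)
      (Finset.sum_nonneg fun l _ => mul_nonneg (pow_apply_nonneg hK n i l) (hM l j))
  have hirr : (returnMatrix K M z).IsIrreducible := by
    refine isIrreducible_of_surjective hG (f := id) (fun i j => tsum_nonneg fun n => hnn n i j)
      Function.surjective_id fun i j hij => ?_
    obtain ⟨n, hn⟩ := exists_pow_mul_pos hK hM hKM hsto hdet hij
    exact (hS i j).tsum_pos (fun n => hnn n i j) n (by positivity)
  obtain ⟨γ, hγ, v, hv, hGv⟩ := exists_pos_eigenvector hirr
  -- First-step decomposition: the term `n = 0` is `z M`, and the others carry a factor `z K` on the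
  -- left. Applied to the Perron vector of the series, it becomes the eigenvector equation for `K +
  -- γ⁻¹ M`.
  have hrec : returnMatrix K M z = z • M + z • (K * returnMatrix K M z) := by
    ext i j
    have h1 : ∀ l, HasSum (fun n : ℕ => K i l * (z ^ (n + 1) * (K ^ n * M) l j))
        (K i l * returnMatrix K M z l j) := fun l => (hS l j).hasSum.mul_left _
    have h2 := (hasSum_sum fun l (_ : l ∈ Finset.univ) => h1 l).mul_left z
    have h3 := (hS i j).hasSum
    rw [← hasSum_nat_add_iff' 1] at h3
    have h4 := h2.unique (h3.congr_fun fun n => ?_)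
    · change z * (K * returnMatrix K M z) i j = returnMatrix K M z i j - _ at h4
      rw [Matrix.add_apply, Matrix.smul_apply, Matrix.smul_apply, smul_eq_mul, smul_eq_mul, h4]
      simp
    · rw [pow_succ' K, mul_assoc, mul_apply, Finset.mul_sum, Finset.mul_sum]
      exact Finset.sum_congr rfl fun l _ => by ring
  refine ⟨γ, hγ, v, hv, hGv, ?_⟩
  have h1 : γ • v = z • (M *ᵥ v) + (z * γ) • (K *ᵥ v) := by
    rw [← hGv]
    nth_rewrite 1 [hrec]
    rw [add_mulVec, smul_mulVec, smul_mulVec, ← mulVec_mulVec, hGv, mulVec_smul, smul_smul]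
  rw [add_mulVec, smul_mulVec]
  funext i
  have h2 := congrFun h1 i
  simp only [Pi.add_apply, Pi.smul_apply, smul_eq_mul] at h2 ⊢
  field_simp
  linarith

end Kernels

end ErasureQueue

namespace ErasureQueue

/-! ### Initial law and Markov property of the trajectory measure. -/

section MarkovChain

open Preorder

variable {S : Type} [Fintype S] [MeasurableSpace S] [MeasurableSingletonClass S]

instance isProbabilityMeasure_markovLaw (Q : S → PMF S) (v : S) :
    IsProbabilityMeasure (markovLaw Q v) := by
  have : IsMarkovKernel (Kernel.ofFunOfCountable fun s => (Q s).toMeasure) :=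
    ⟨fun s => PMF.toMeasure.isProbabilityMeasure (Q s)⟩
  unfold markovLaw
  infer_instance

theorem markovLaw_map_zero (Q : S → PMF S) (v : S) :
    (markovLaw Q v).map (fun ω => ω 0) = Measure.dirac v := by
  have : IsMarkovKernel (Kernel.ofFunOfCountable fun s => (Q s).toMeasure) :=
    ⟨fun s => PMF.toMeasure.isProbabilityMeasure (Q s)⟩
  have h : (fun ω : ℕ → S => ω 0) =
      (fun x : (i : Finset.Iic 0) → S => x ⟨0, Finset.mem_Iic.mpr le_rfl⟩) ∘
        frestrictLe (π := fun _ => S) 0 := rfl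
  have hm : Measurable
      (fun x : (i : Finset.Iic 0) → S => x ⟨0, Finset.mem_Iic.mpr le_rfl⟩) := measurable_pi_apply _
  rw [h, ← Measure.map_map hm (measurable_frestrictLe 0)]
  unfold markovLaw Kernel.trajMeasure
  rw [Measure.map_comp _ _ (measurable_frestrictLe 0), Kernel.traj_map_frestrictLe,
    Kernel.partialTraj_self, Measure.id_comp, Measure.map_dirac' (by fun_prop),
    Measure.map_dirac' hm]
  rfl

/-- The Markov property: the next state has law `Q a` if the present one is known to be such that
its one-step law agrees with `Q a` at `b`. -/
theorem markovLaw_inter (Q : S → PMF S) (v : S) {n : ℕ} (s : Set ((i : Finset.Iic n) → S))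
    {b : S} {q : ℝ≥0∞} (hs : ∀ x ∈ s, Q (x ⟨n, Finset.mem_Iic.mpr le_rfl⟩) b = q) :
    markovLaw Q v (frestrictLe (π := fun _ => S) n ⁻¹' s ∩ {ω | ω (n + 1) = b}) =
      markovLaw Q v (frestrictLe (π := fun _ => S) n ⁻¹' s) * q := by
  have : IsMarkovKernel (Kernel.ofFunOfCountable fun s => (Q s).toMeasure) :=
    ⟨fun s => PMF.toMeasure.isProbabilityMeasure (Q s)⟩
  have hms : MeasurableSet s := .of_discrete
  have hmb : MeasurableSet ({b} : Set S) := measurableSet_singleton b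
  have h := congrArg (fun μ => μ (s ×ˢ {b}))
    (Kernel.map_frestrictLe_trajMeasure_compProd_eq_map_trajMeasure (X := fun _ => S)
      (μ₀ := Measure.dirac v) (κ := fun n =>
        (Kernel.ofFunOfCountable fun s => (Q s).toMeasure).comap
          (fun x : (i : Finset.Iic n) → S => x ⟨n, Finset.mem_Iic.mpr le_rfl⟩)
          (measurable_pi_apply _)) (a := n))
  rw [Measure.compProd_apply_prod hms hmb, Measure.map_apply
    ((measurable_frestrictLe n).prodMk (measurable_pi_apply _)) (hms.prod hmb)] at h
  have h2 : ∀ x ∈ s, ((Kernel.ofFunOfCountable fun s => (Q s).toMeasure).comap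
      (fun x : (i : Finset.Iic n) → S => x ⟨n, Finset.mem_Iic.mpr le_rfl⟩)
      (measurable_pi_apply _)) x {b} = q := by
    intro x hx
    rw [Kernel.comap_apply, ← hs x hx]
    exact PMF.toMeasure_apply_singleton _ _ hmb
  rw [setLIntegral_congr_fun hms h2, setLIntegral_const,
    Measure.map_apply (measurable_frestrictLe n) hms, mul_comm] at h
  exact h.symm

end MarkovChain

/-! ### Law of the sojourn time and its generating matrix. -/

namespace System

open Preorder

variable {k : ℕ} (S : System k)

/-- The codewords before `n` have failed and the channel is in state `a` at the onset of `n`. -/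
def failSet (n : ℕ) (a : Fin k) : Set (ℕ → Fin k × Bool) :=
  frestrictLe (π := fun _ => Fin k × Bool) n ⁻¹'
    {x | (∀ m (h : m < n), (x ⟨m + 1, Finset.mem_Iic.mpr h⟩).2 = false) ∧
      (x ⟨n, Finset.mem_Iic.mpr le_rfl⟩).1 = a}

theorem mem_failSet {n : ℕ} {a : Fin k} {ω : ℕ → Fin k × Bool} :
    ω ∈ failSet n a ↔ (∀ m < n, (ω (m + 1)).2 = false) ∧ (ω n).1 = a := Iff.rfl

theorem measurableSet_failSet (n : ℕ) (a : Fin k) : MeasurableSet (failSet n a) :=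
  measurable_frestrictLe n .of_discrete

theorem measurableSet_next_eq (n : ℕ) (b : Fin k × Bool) :
    MeasurableSet {ω : ℕ → Fin k × Bool | ω (n + 1) = b} :=
  have hm : Measurable fun ω : ℕ → Fin k × Bool => ω (n + 1) := measurable_pi_apply _
  hm (measurableSet_singleton b)

theorem law_failSet_inter (i a : Fin k) (n : ℕ) (b : Fin k × Bool) :
    S.law i (failSet n a ∩ {ω | ω (n + 1) = b}) = S.law i (failSet n a) * S.blockLaw a b :=
  markovLaw_inter _ _ _ fun x hx => by rw [hx.2]

theorem law_iUnion_failSet (i : Fin k) (n : ℕ) (b : Fin k × Bool) :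
    S.law i (⋃ a, failSet n a ∩ {ω | ω (n + 1) = b}) =
      ∑ a, S.law i (failSet n a) * S.blockLaw a b := by
  rw [measure_iUnion, tsum_fintype]
  · exact Finset.sum_congr rfl fun a _ => S.law_failSet_inter i a n b
  · intro a a' h
    refine Set.disjoint_left.2 fun ω h1 h2 => h ?_
    rw [← (mem_failSet.1 h1.1).2, ← (mem_failSet.1 h2.1).2]
  · exact fun a => (measurableSet_failSet n a).inter (measurableSet_next_eq n b)

theorem matK_nonneg (i j : Fin k) : 0 ≤ S.matK i j := ENNReal.toReal_nonneg

theorem matM_nonneg (i j : Fin k) : 0 ≤ S.matM i j := ENNReal.toReal_nonneg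

theorem blockLaw_false (i j : Fin k) :
    S.blockLaw i (j, false) = ENNReal.ofReal (S.matK i j) :=
  (ENNReal.ofReal_toReal (PMF.apply_ne_top _ _)).symm

theorem blockLaw_true (i j : Fin k) :
    S.blockLaw i (j, true) = ENNReal.ofReal (S.matM i j) :=
  (ENNReal.ofReal_toReal (PMF.apply_ne_top _ _)).symm

theorem law_failSet (i : Fin k) (n : ℕ) (a : Fin k) :
    S.law i (failSet n a) = ENNReal.ofReal ((S.matK ^ n) i a) := by
  induction n generalizing a with
  | zero =>
    have h : failSet 0 a = (fun ω : ℕ → Fin k × Bool => ω 0) ⁻¹' {w | w.1 = a} := by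
      ext ω
      simp [mem_failSet]
    rw [h, ← Measure.map_apply (measurable_pi_apply 0) .of_discrete]
    unfold law
    rw [markovLaw_map_zero, Measure.dirac_apply' _ .of_discrete, pow_zero, Matrix.one_apply]
    simp only [Set.indicator_apply, Set.mem_ofPred_eq, Pi.one_apply]
    split_ifs <;> simp
  | succ n ih =>
    have h : failSet (n + 1) a = ⋃ l, failSet n l ∩ {ω | ω (n + 1) = (a, false)} := by
      ext ω
      simp only [Set.mem_iUnion, Set.mem_inter_iff, mem_failSet, Set.mem_ofPred_eq]
      constructor
      · rintro ⟨h1, h2⟩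
        exact ⟨_, ⟨fun m hm => h1 m (by omega), rfl⟩, Prod.ext h2 (h1 n (by omega))⟩
      · rintro ⟨l, ⟨h1, -⟩, h2⟩
        refine ⟨fun m hm => ?_, by rw [h2]⟩
        rcases Nat.lt_succ_iff_lt_or_eq.1 hm with hm | rfl
        · exact h1 m hm
        · rw [h2]
    have hnn : ∀ l ∈ Finset.univ, 0 ≤ (S.matK ^ n) i l * S.matK l a := fun l _ =>
      mul_nonneg (Matrix.pow_apply_nonneg S.matK_nonneg n i l) (S.matK_nonneg l a)
    rw [h, law_iUnion_failSet, pow_succ, Matrix.mul_apply, ENNReal.ofReal_sum_of_nonneg hnn]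
    refine Finset.sum_congr rfl fun l _ => ?_
    rw [ih, blockLaw_false,
      ENNReal.ofReal_mul (Matrix.pow_apply_nonneg S.matK_nonneg n i l)]

/-- The queue started at level `1` empties at time `n + 1`, with the channel in state `j`. -/
def departSet (n : ℕ) (j : Fin k) : Set (ℕ → Fin k × Bool) :=
  ⋃ a, failSet n a ∩ {ω | ω (n + 1) = (j, true)}

theorem mem_departSet {n : ℕ} {j : Fin k} {ω : ℕ → Fin k × Bool} :
    ω ∈ departSet n j ↔ (∀ m < n, (ω (m + 1)).2 = false) ∧ ω (n + 1) = (j, true) := by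
  simp [departSet, mem_failSet]

theorem measurableSet_departSet (n : ℕ) (j : Fin k) : MeasurableSet (departSet n j) :=
  .iUnion fun a => (measurableSet_failSet n a).inter (measurableSet_next_eq n _)

theorem law_departSet (i : Fin k) (n : ℕ) (j : Fin k) :
    S.law i (departSet n j) = ENNReal.ofReal ((S.matK ^ n * S.matM) i j) := by
  have hnn : ∀ l ∈ Finset.univ, 0 ≤ (S.matK ^ n) i l * S.matM l j := fun l _ =>
    mul_nonneg (Matrix.pow_apply_nonneg S.matK_nonneg n i l) (S.matM_nonneg l j)
  rw [departSet, law_iUnion_failSet, Matrix.mul_apply, ENNReal.ofReal_sum_of_nonneg hnn]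
  refine Finset.sum_congr rfl fun l _ => ?_
  rw [law_failSet, blockLaw_true,
    ENNReal.ofReal_mul (Matrix.pow_apply_nonneg S.matK_nonneg n i l)]

theorem queue_of_fail {ω : ℕ → Fin k × Bool} {n : ℕ} (h : ∀ m < n, (ω (m + 1)).2 = false) :
    queue 1 ω n = 1 := by
  induction n with
  | zero => rfl
  | succ n ih => simp [queue, ih fun m hm => h m (by omega), h n (by omega)]

theorem sojourn_of_fail {ω : ℕ → Fin k × Bool} (h : ∀ m, (ω (m + 1)).2 = false) :
    sojourn ω = ⊤ := by
  simp [sojourn, queue_of_fail fun m (_ : m < _) => h m]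

theorem sojourn_of_depart {ω : ℕ → Fin k × Bool} {n : ℕ}
    (h : ∀ m < n, (ω (m + 1)).2 = false) (hn : (ω (n + 1)).2 = true) :
    sojourn ω = ((n + 1 : ℕ) : ℕ∞) := by
  refine le_antisymm (iInf₂_le (n + 1) (by simp [queue, queue_of_fail h, hn])) ?_
  refine le_iInf₂ fun s hs => ?_
  by_contra! hlt
  have hlt' : s < n + 1 := by exact_mod_cast hlt
  rw [queue_of_fail fun m hm => h m (by omega)] at hs
  exact one_ne_zero hs

/-- The events `departSet n j` are disjoint in `n`, so at most one summand survives: the one of the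
first success. The success of codeword `n` is recorded at index `n + 1`, whence the exponent. -/
theorem sojourn_integrand (z : ℝ≥0∞) (j : Fin k) (ω : ℕ → Fin k × Bool) :
    (if sojourn ω ≠ ⊤ ∧ (ω (sojourn ω).toNat).1 = j then z ^ (sojourn ω).toNat else 0) =
      ∑' n : ℕ, (departSet n j).indicator (fun _ => z ^ (n + 1)) ω := by
  by_cases hex : ∃ n, (ω (n + 1)).2 = true
  · classical
    have hn := Nat.find_spec hex
    have hmin : ∀ m < Nat.find hex, (ω (m + 1)).2 = false := fun m hm => by
      simpa using Nat.find_min hex hm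
    generalize Nat.find hex = n at hn hmin
    rw [sojourn_of_depart hmin hn, tsum_eq_single n]
    · by_cases hj : (ω (n + 1)).1 = j
      · have : ω ∈ departSet n j := mem_departSet.2 ⟨hmin, Prod.ext hj hn⟩
        rw [Set.indicator_of_mem this, if_pos ⟨ENat.natCast_ne_top _, hj⟩]
        rfl
      · have : ω ∉ departSet n j := fun h => hj (by rw [(mem_departSet.1 h).2])
        rw [Set.indicator_of_notMem this, if_neg fun h => hj h.2]
    · intro m hm
      refine Set.indicator_of_notMem (fun h => ?_) _
      obtain ⟨h1, h2⟩ := mem_departSet.1 h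
      rcases lt_or_gt_of_ne hm with hlt | hlt
      · simpa [h2] using hmin m hlt
      · simpa [hn] using h1 n hlt
  · have hall : ∀ m, (ω (m + 1)).2 = false := by simpa using hex
    rw [sojourn_of_fail hall, if_neg (by simp)]
    refine (ENNReal.tsum_eq_zero.2 fun n => Set.indicator_of_notMem (fun h => ?_) _).symm
    simpa [(mem_departSet.1 h).2] using hall n

theorem genT_apply (z : ℝ≥0∞) (i j : Fin k) :
    S.genT z i j = ∑' n : ℕ, z ^ (n + 1) * ENNReal.ofReal ((S.matK ^ n * S.matM) i j) := by
  rw [genT, Matrix.of_apply]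
  simp_rw [sojourn_integrand]
  rw [lintegral_tsum fun n => (measurable_const.indicator (measurableSet_departSet n j)).aemeasurable]
  refine tsum_congr fun n => ?_
  rw [lintegral_indicator_const (measurableSet_departSet n j), law_departSet]

end System

end ErasureQueue

namespace ErasureQueue

/-! ### Correspondence between the two spectral radii. -/

namespace System

open Matrix

variable {k : ℕ} (S : System k)

theorem matK_add_matM_mulVec_one : (S.matK + S.matM) *ᵥ 1 = 1 := by
  funext i
  have h1 : ∑ w, S.blockLaw i w = 1 := (tsum_fintype _).symm.trans (PMF.tsum_coe _)
  have h2 := congrArg ENNReal.toReal h1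
  rw [ENNReal.toReal_sum fun w _ => PMF.apply_ne_top _ _, Fintype.sum_prod_type] at h2
  simpa [mulVec, dotProduct, matK, matM, add_comm] using h2

theorem isIrreducible_matK_add_smul [NeZero k] (hPi : S.matPi.IsIrreducible) {c : ℝ}
    (hc : 0 < c) : (S.matK + c • S.matM).IsIrreducible := by
  have hK := S.matK_nonneg
  have hM : ∀ i j, 0 ≤ c * S.matM i j := fun i j => mul_nonneg hc.le (S.matM_nonneg i j)
  refine isIrreducible_of_surjective hPi (f := Prod.fst)
    (fun i j => add_nonneg (hK i j) (hM i j)) Prod.fst_surjective ?_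
  rintro ⟨i, d⟩ ⟨j, b⟩ h
  cases b
  · exact add_pos_of_pos_of_nonneg h (hM i j)
  · exact add_pos_of_nonneg_of_pos (hK i j) (mul_pos hc h)

/-- The rows of the tilted matrix do not depend on the current indicator `d`, so `v` lifts to an
eigenvector constant in `d`. -/
theorem specRadius_tiltedPi [NeZero k] {θ φ : ℝ} (hφ : 0 ≤ φ) {v : Fin k → ℝ}
    (hv : ∀ i, 0 < v i) (h : (S.matK + Real.exp θ • S.matM) *ᵥ v = φ • v) :
    specRadius (S.tiltedPi θ) = ENNReal.ofReal φ := by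
  refine specRadius_eq_of_pos_eigenvector (v := fun w => v w.1)
    (fun w w' => mul_nonneg ENNReal.toReal_nonneg (Real.exp_pos _).le) hφ (fun w => hv w.1) ?_
  funext ⟨i, d⟩
  rw [Pi.smul_apply]
  refine Eq.trans ?_ (congrFun h i)
  simp only [mulVec, dotProduct, Fintype.sum_prod_type, Fintype.sum_bool]
  refine Finset.sum_congr rfl fun j _ => ?_
  simp [matK, matM]
  ring

/-- The inverse of a singular matrix is `0` by convention, and the zero matrix is not irreducible.
-/
theorem isUnit_det_one_sub_matK [NeZero k] (hG : ((1 - S.matK)⁻¹ * S.matM).IsIrreducible) :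
    IsUnit (1 - S.matK).det := by
  by_contra hdet
  rw [nonsing_inv_apply_not_isUnit _ hdet, zero_mul] at hG
  obtain ⟨n, hn, hn'⟩ := (isIrreducible_iff_exists_pow_pos hG.nonneg).1 hG 0 0
  rw [zero_pow hn.ne'] at hn'
  exact lt_irrefl _ hn'

theorem genT_ofReal {z : ℝ} (hz : 0 ≤ z) (i j : Fin k) :
    S.genT (ENNReal.ofReal z) i j =
      ∑' n : ℕ, ENNReal.ofReal (z ^ (n + 1) * (S.matK ^ n * S.matM) i j) := by
  rw [genT_apply]
  refine tsum_congr fun n => ?_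
  rw [ENNReal.ofReal_mul (pow_nonneg hz _), ENNReal.ofReal_pow hz]

theorem term_nonneg {z : ℝ} (hz : 0 ≤ z) (n : ℕ) (i j : Fin k) :
    0 ≤ z ^ (n + 1) * (S.matK ^ n * S.matM) i j :=
  mul_nonneg (pow_nonneg hz _) <| by
    rw [mul_apply]
    exact Finset.sum_nonneg fun l _ =>
      mul_nonneg (pow_apply_nonneg S.matK_nonneg n i l) (S.matM_nonneg l j)

theorem summable_of_genT_ne_top {z : ℝ} (hz : 0 ≤ z) {i j : Fin k}
    (h : S.genT (ENNReal.ofReal z) i j ≠ ∞) :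
    Summable fun n : ℕ => z ^ (n + 1) * (S.matK ^ n * S.matM) i j := by
  rw [genT_ofReal S hz] at h
  refine (ENNReal.summable_toReal h).congr fun n => ?_
  exact ENNReal.toReal_ofReal (S.term_nonneg hz n i j)

theorem genT_eq_ofReal {z : ℝ} (hz : 0 ≤ z) {i j : Fin k}
    (h : Summable fun n : ℕ => z ^ (n + 1) * (S.matK ^ n * S.matM) i j) :
    S.genT (ENNReal.ofReal z) i j = ENNReal.ofReal (returnMatrix S.matK S.matM z i j) := by
  rw [genT_ofReal S hz, returnMatrix, Matrix.of_apply,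
    ENNReal.ofReal_tsum_of_nonneg (fun n => S.term_nonneg hz n i j) h]

theorem extSpecRadius_genT [NeZero k] {z : ℝ} (hz : 0 ≤ z)
    (h : ∀ i j, Summable fun n : ℕ => z ^ (n + 1) * (S.matK ^ n * S.matM) i j)
    {γ : ℝ} (hγ : 0 ≤ γ) {v : Fin k → ℝ} (hv : ∀ i, 0 < v i)
    (hGv : returnMatrix S.matK S.matM z *ᵥ v = γ • v) :
    extSpecRadius (S.genT (ENNReal.ofReal z)) = ENNReal.ofReal γ := by
  have hnn : ∀ i j, 0 ≤ returnMatrix S.matK S.matM z i j := fun i j =>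
    tsum_nonneg fun n => S.term_nonneg hz n i j
  have hmap : (S.genT (ENNReal.ofReal z)).map ENNReal.toReal = returnMatrix S.matK S.matM z := by
    ext i j
    rw [map_apply, S.genT_eq_ofReal hz (h i j), ENNReal.toReal_ofReal (hnn i j)]
  rw [extSpecRadius, if_neg, hmap, specRadius_eq_of_pos_eigenvector hnn hγ hv hGv]
  rintro ⟨i, j, hij⟩
  rw [S.genT_eq_ofReal hz (h i j)] at hij
  exact ENNReal.ofReal_ne_top hij

/-- Each point of the graph of `log ϱ(tiltedPi)` corresponds to one of `log ϱ(genT)`. -/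
theorem exists_log_specRadius_tiltedPi [NeZero k]
    (hG : ((1 - S.matK)⁻¹ * S.matM).IsIrreducible) (hPi : S.matPi.IsIrreducible) (θ : ℝ) :
    ∃ l : ℝ, ENNReal.log (specRadius (S.tiltedPi θ)) = ((-l : ℝ) : EReal) ∧
      ENNReal.log (extSpecRadius (S.genT (ENNReal.ofReal (Real.exp l)))) = ((-θ : ℝ) : EReal) := by
  have hc := Real.exp_pos θ
  have hirr := S.isIrreducible_matK_add_smul hPi hc
  obtain ⟨φ, hφ, v, hv, h⟩ := exists_pos_eigenvector hirr
  have hdet := S.isUnit_det_one_sub_matK hG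
  have hKM : (S.matK + S.matM).IsIrreducible := by
    simpa using S.isIrreducible_matK_add_smul hPi one_pos
  obtain ⟨hS, hGv⟩ := summable_of_eigenvector S.matK_nonneg S.matM_nonneg hKM
    S.matK_add_matM_mulVec_one (fun _ => eq_zero_of_mulVec_eq hdet) hc hφ hirr hv h
  refine ⟨-Real.log φ, ?_, ?_⟩
  · rw [S.specRadius_tiltedPi hφ.le hv h, ENNReal.log_ofReal_of_pos hφ, neg_neg]
  · rw [Real.exp_neg, Real.exp_log hφ,
      S.extSpecRadius_genT (inv_nonneg.2 hφ.le) hS (inv_nonneg.2 hc.le) hv hGv,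
      ← Real.exp_neg, ENNReal.log_ofReal_of_pos (Real.exp_pos _), Real.log_exp]

/-- Each finite point of the graph of `log ϱ(genT)` corresponds to one of `log ϱ(tiltedPi)`. -/
theorem log_extSpecRadius_genT [NeZero k]
    (hG : ((1 - S.matK)⁻¹ * S.matM).IsIrreducible) (hPi : S.matPi.IsIrreducible) (l : ℝ) :
    ENNReal.log (extSpecRadius (S.genT (ENNReal.ofReal (Real.exp l)))) = ⊤ ∨
    ∃ θ : ℝ, ENNReal.log (specRadius (S.tiltedPi θ)) = ((-l : ℝ) : EReal) ∧
      ENNReal.log (extSpecRadius (S.genT (ENNReal.ofReal (Real.exp l)))) = ((-θ : ℝ) : EReal) := by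
  by_cases hfin : ∃ i j, S.genT (ENNReal.ofReal (Real.exp l)) i j = ∞
  · left
    rw [extSpecRadius, if_pos hfin, ENNReal.log_top]
  · right
    push Not at hfin
    have hz := Real.exp_pos l
    have hS := fun i j => S.summable_of_genT_ne_top hz.le (hfin i j)
    have hKM : (S.matK + S.matM).IsIrreducible := by
      simpa using S.isIrreducible_matK_add_smul hPi one_pos
    obtain ⟨γ, hγ, v, hv, hGv, h⟩ := exists_eigenvector_of_summable S.matK_nonneg S.matM_nonneg
      hKM S.matK_add_matM_mulVec_one (S.isUnit_det_one_sub_matK hG) hG hz hS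
    refine ⟨-Real.log γ, ?_, ?_⟩
    · have h' : (S.matK + Real.exp (-Real.log γ) • S.matM) *ᵥ v = (Real.exp l)⁻¹ • v := by
        rwa [Real.exp_neg, Real.exp_log hγ]
      rw [S.specRadius_tiltedPi (inv_nonneg.2 hz.le) hv h', ← Real.exp_neg,
        ENNReal.log_ofReal_of_pos (Real.exp_pos _), Real.log_exp]
    · rw [S.extSpecRadius_genT hz.le hS hγ.le hv hGv, ENNReal.log_ofReal_of_pos hγ, neg_neg]

end System

end ErasureQueue

/-! ### Comparison of the two Legendre transforms. -/

theorem proposition3 {k : ℕ} (S : ErasureQueue.System k)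
    -- the channel is irreducible, aperiodic and not always erasing
    (hirr : S.B.IsIrreducible)
    (haper : ErasureQueue.IsAperiodic S.B)
    (hε : ∃ i, S.ε i < 1)
    -- the channel sampled at departures is irreducible
    (hG : ((1 - S.matK)⁻¹ * S.matM).IsIrreducible)
    -- the chain (channel state, success indicator) is irreducible
    (hPi : S.matPi.IsIrreducible)
    -- both rate functions are finite
    (hLambda : ∀ y : ℝ, 1 < y → S.rateLambda y ≠ ⊥ ∧ S.rateLambda y ≠ ⊤)
    (hI : ∀ y : ℝ, 0 < y → y < 1 → S.rateI y ≠ ⊥ ∧ S.rateI y ≠ ⊤) :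
    ∀ x : ℝ, 0 < x → x < 1 → S.rateI x = (x : EReal) * S.rateLambda (1 / x) := by
  intro x hx0 hx1
  obtain ⟨i₀, -⟩ := hε
  have : NeZero k := ⟨fun h => (Fin.cast h i₀).elim0⟩
  obtain ⟨hL1, hL2⟩ := hLambda (1 / x) ((one_lt_div hx0).2 hx1)
  obtain ⟨hI1, hI2⟩ := hI x hx0 hx1
  lift S.rateLambda (1 / x) to ℝ using ⟨hL2, hL1⟩ with L hL
  lift S.rateI x to ℝ using ⟨hI2, hI1⟩ with J hJ
  rw [← EReal.coe_mul, EReal.coe_eq_coe_iff]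
  apply le_antisymm
  -- Every `θ` has a partner `l` whose term in the other supremum, multiplied by `x`, is the same
  -- number.
  · have h : S.rateI x ≤ ((x * L : ℝ) : EReal) := by
      refine iSup_le fun θ => ?_
      obtain ⟨l, h1, h2⟩ := S.exists_log_specRadius_tiltedPi hG hPi θ
      have h3 : ((l * (1 / x) : ℝ) : EReal) - ((-θ : ℝ) : EReal) ≤ (L : EReal) := by
        rw [hL, ← h2]
        exact le_iSup (fun l : ℝ => ((l * (1 / x) : ℝ) : EReal) -
          ENNReal.log (ErasureQueue.extSpecRadius (S.genT (ENNReal.ofReal (Real.exp l))))) l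
      rw [← EReal.coe_sub, EReal.coe_le_coe_iff] at h3
      rw [h1, ← EReal.coe_sub, EReal.coe_le_coe_iff]
      calc θ * x - -l = x * (l * (1 / x) - -θ) := by field_simp; ring
        _ ≤ x * L := mul_le_mul_of_nonneg_left h3 hx0.le
    rwa [← hJ, EReal.coe_le_coe_iff] at h
  -- Here only those `l` with a finite generating matrix have a partner; the remaining terms are
  -- `⊥`.
  · have h : S.rateLambda (1 / x) ≤ ((J / x : ℝ) : EReal) := by
      refine iSup_le fun l => ?_
      rcases S.log_extSpecRadius_genT hG hPi l with h1 | ⟨θ, h1, h2⟩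
      · rw [h1, EReal.sub_top]
        exact bot_le
      have h3 : ((θ * x : ℝ) : EReal) - ((-l : ℝ) : EReal) ≤ (J : EReal) := by
        rw [hJ, ← h1]
        exact le_iSup (fun θ : ℝ => ((θ * x : ℝ) : EReal) -
          ENNReal.log (ErasureQueue.specRadius (S.tiltedPi θ))) θ
      rw [← EReal.coe_sub, EReal.coe_le_coe_iff] at h3
      rw [h2, ← EReal.coe_sub, EReal.coe_le_coe_iff, le_div_iff₀ hx0]
      calc (l * (1 / x) - -θ) * x = θ * x - -l := by field_simp; ring
        _ ≤ J := h3
    rw [← hL, EReal.coe_le_coe_iff, le_div_iff₀ hx0] at h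
    linarith
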